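/- **Conventions.** Let $S$ be a semigroup that is cancellative (all maps $L_s:x\mapsto sx$ and $R_s:x\mapsto xs$ are injective) and left amenable: there is a finitely additive probability measure $\mu:\mathcal P(S)\to[0,1]$ with $\mu(S)=1$ and $\mu(L_s^{-1}(E))=\mu(E)$ for all $s\in S$, $E\subseteq S$. Let $\mathcal P_{fin}(S)$ be the set of nonempty finite subsets of $S$. A net $(F_i)_{i\in I}$ in $\mathcal P_{fin}(S)$ is a left Følner net if $\lim_i |sF_i\setminus F_i|/|F_i|=0$ for every $s\in S$. For $f:\mathcal P_{fin}(S)\to\mathbb R$ put $$\overline{\mathcal H}(f)=\limsup_{F}\frac{f(F)}{|F|},\qquad \underline{\mathcal H}(f)=\liminf_{F}\frac{f(F)}{|F|}\qquad(\text{in }[-\infty,\infty]),$$ the upper and lower limits being taken along the filter on $\mathcal P_{fin}(S)$ generated by the sets $\{F: |sF\setminus F|\le\varepsilon|F|\text{ for all } s\in E\}$, with $E\subseteq S$ finite and $\varepsilon>0$. The left Følner nets are exactly the nets converging to this filter; so, whenever $f(F_i)/|F_i|$ has the same limit along all left Følner nets, both quantities equal that limit, and this is the case for the functions $f$ below by the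 Ornstein–Weiss lemma for cancellative left amenable semigroups. *Algebraic entropy.* Let $\alpha$ be a right action of $S$ on a discrete abelian group $A$ by endomorphisms ($\alpha(st)=\alpha(t)\circ\alpha(s)$). For a nonempty finite $X\subseteq A$ and $F\in\mathcal P_{fin}(S)$ let $T_F(\alpha,X)=\sum_{s\in F}\alpha(s)(X)$, $f_X(F)=\log|T_F(\alpha,X)|$, and $$h^r_{alg}(\alpha)=\sup_X\overline{\mathcal H}(f_X),\qquad \underline h^r_{alg}(\alpha)=\sup_X\underline{\mathcal H}(f_X).$$ *Topological entropy.* Let $\gamma$ be a left action of $S$ on a compact space $C$ by continuous maps ($\gamma(st)=\gamma(s)\circ\gamma(t)$). For an open cover $\mathcal U$ of $C$ let $N(\mathcal U)$ be the least positive size of a subcover, $\mathcal U_{\gamma,F}=\bigvee_{s\in F}\gamma(s)^{-1}(\mathcal U)$, $f_{\mathcal U}(F)=\log N(\mathcal U_{\gamma,F})$, and $$h_{top}(\gamma)=\sup_{\mathcal U}\overline{\mathcal H}(f_{\mathcal U}),\qquad \underline h_{top}(\gamma)=\sup_{\mathcal U}\underline{\mathcal H}(f_{\mathcal U}).$$ *Dual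 actions.* For an abelian topological group $G$, let $\widehat G$ be its Pontryagin dual. A right (left) action $\beta$ of $S$ on $G$ by continuous endomorphisms induces a left (right) action $\widehat\beta$ of $S$ on $\widehat G$ by $\widehat\beta(s)(\chi)=\chi\circ\beta(s)$. **Theorem (Bridge Theorem).** Let $S$ be a cancellative left amenable semigroup. 1. If $\alpha$ is a right action of $S$ by endomorphisms on a (discrete) torsion abelian group $A$, then $h^r_{alg}(\alpha)=h_{top}(\widehat\alpha)$. 2. If $\gamma$ is a left action of $S$ by continuous endomorphisms on a totally disconnected compact abelian group $K$, then $h_{top}(\gamma)=h^r_{alg}(\widehat\gamma)$. Moreover, the values do not depend on whether upper or lower limits are used: $\underline h^r_{alg}(\alpha)=h^r_{alg}(\alpha)$ and $\underline h_{top}(\widehat\alpha)=h_{top}(\widehat\alpha)$ in (1), and $\underline h_{top}(\gamma)=h_{top}(\gamma)$ and $\underline h^r_{alg}(\widehat\gamma)=h^r_{alg}(\widehat\gamma)$ in (2). -/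

import Mathlib

open Filter Topology
open scoped Pointwise

namespace Bridge

/-! ### Amenable semigroups, Følner nets, Følner limits -/

section Semigroups

variable (S : Type*) [Mul S]

/-- Left amenability: there is a finitely additive probability measure `μ : 𝒫(S) → [0,1]` with
`μ (L_s⁻¹ F) = μ F` for all `s` and `F`, where `L_s x = s x`. -/
def LeftAmenable : Prop :=
  ∃ μ : Set S → ℝ,
    (∀ F, μ F ∈ Set.Icc (0 : ℝ) 1) ∧
    μ Set.univ = 1 ∧
    (∀ F E : Set S, Disjoint F E → μ (F ∪ E) = μ F + μ E) ∧
    (∀ (s : S) (F : Set S), μ ((fun x => s * x) ⁻¹' F) = μ F)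

variable {S}

/-- The ratio `|sF \ F| / |F|`. -/
noncomputable def foelnerRatio (s : S) (F : Finset S) : ℝ :=
  (((fun x => s * x) '' (F : Set S)) \ (F : Set S)).ncard / (F.card : ℝ)

/-- A left Følner net: a net of nonempty finite sets such that `|s F_i \ F_i| / |F_i| → 0` for
every `s`. -/
def IsLeftFoelnerNet {ι : Type*} [Preorder ι] (F : ι → Finset S) : Prop :=
  (∀ i, (F i).Nonempty) ∧ ∀ s : S, Tendsto (fun i => foelnerRatio s (F i)) atTop (𝓝 0)

variable (S)

/-- The filter of left Følner sets on the finite subsets of `S`. A net of nonempty finite subsets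
is a left Følner net exactly when it converges to this filter, so a limit along this filter is a
common limit along all left Følner nets. -/
noncomputable def foelnerFilter : Filter (Finset S) :=
  𝓟 {F | F.Nonempty} ⊓ ⨅ s : S, comap (foelnerRatio s) (𝓝 0)

variable {S}

theorem isLeftFoelnerNet_iff {ι : Type*} [Preorder ι] (F : ι → Finset S)
    (hF : ∀ i, (F i).Nonempty) :
    IsLeftFoelnerNet F ↔ Tendsto F atTop (foelnerFilter S) := by
  simp [IsLeftFoelnerNet, foelnerFilter, tendsto_inf, tendsto_iInf, tendsto_comap_iff,
    Function.comp_def, hF]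

/-- The upper limit of `f F / |F|` over left Følner sets `F`. -/
noncomputable def foelnerLimsup (f : Finset S → ℝ) : EReal :=
  limsup (fun F : Finset S => ((f F / (F.card : ℝ) : ℝ) : EReal)) (foelnerFilter S)

/-- The lower limit of `f F / |F|` over left Følner sets `F`. -/
noncomputable def foelnerLiminf (f : Finset S → ℝ) : EReal :=
  liminf (fun F : Finset S => ((f F / (F.card : ℝ) : ℝ) : EReal)) (foelnerFilter S)

/-- Whenever `f F_i / |F_i|` has a common limit along the left Følner nets, both notions give that
limit. -/
theorem foelnerLim_eq [NeBot (foelnerFilter S)] {f : Finset S → ℝ} {c : ℝ}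
    (h : Tendsto (fun F : Finset S => f F / (F.card : ℝ)) (foelnerFilter S) (𝓝 c)) :
    foelnerLimsup f = c ∧ foelnerLiminf f = c := by
  have h' := (continuous_coe_real_ereal.tendsto c).comp h
  exact ⟨h'.limsup_eq, h'.liminf_eq⟩

end Semigroups

/-! ### Actions by continuous endomorphisms, and their duals

Abelian groups are written multiplicatively. On a discrete group every endomorphism is
continuous. -/

/-- A left action of the semigroup `S` on `G` by continuous endomorphisms. -/
structure LeftAction (S G : Type*) [Mul S] [Monoid G] [TopologicalSpace G] where
  toFun : S → (G →ₜ* G)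
  map_mul : ∀ s t, toFun (s * t) = (toFun s).comp (toFun t)

/-- A right action of the semigroup `S` on `G` by continuous endomorphisms. -/
structure RightAction (S G : Type*) [Mul S] [Monoid G] [TopologicalSpace G] where
  toFun : S → (G →ₜ* G)
  map_mul : ∀ s t, toFun (s * t) = (toFun t).comp (toFun s)

/-- The dual right action of `S` on the Pontryagin dual: `s` acts by `χ ↦ χ ∘ γ(s)`. -/
noncomputable def LeftAction.dual {S G : Type*} [Mul S] [CommGroup G] [TopologicalSpace G]
    (γ : LeftAction S G) : RightAction S (PontryaginDual G) where
  toFun s := PontryaginDual.map (γ.toFun s)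
  map_mul s t := by rw [γ.map_mul, PontryaginDual.map_comp]

/-- The dual left action of `S` on the Pontryagin dual: `s` acts by `χ ↦ χ ∘ α(s)`. -/
noncomputable def RightAction.dual {S G : Type*} [Mul S] [CommGroup G] [TopologicalSpace G]
    (α : RightAction S G) : LeftAction S (PontryaginDual G) where
  toFun s := PontryaginDual.map (α.toFun s)
  map_mul s t := by rw [α.map_mul, PontryaginDual.map_comp]

/-! ### Algebraic entropy of a right action -/

section Algebraic

variable {S A : Type*} [Mul S] [CommGroup A] [TopologicalSpace A]

/-- The trajectory `T_F(α, X)`: the (pointwise) product of the sets `α(s)(X)`, `s ∈ F`. -/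
def trajectory (α : RightAction S A) (X : Finset A) (F : Finset S) : Set A :=
  ∏ s ∈ F, (α.toFun s) '' (X : Set A)

/-- `F ↦ log |T_F(α, X)|`. -/
noncomputable def logTrajectory (α : RightAction S A) (X : Finset A) (F : Finset S) : ℝ :=
  Real.log (trajectory α X F).ncard

/-- The algebraic entropy of a right action: the supremum over nonempty finite `X` of the limit of
`log |T_F(α, X)| / |F|` over left Følner sets `F`. -/
noncomputable def algEntropy (α : RightAction S A) : EReal :=
  ⨆ (X : Finset A) (_ : X.Nonempty), foelnerLimsup (logTrajectory α X)

/-- The algebraic entropy, with lower limits in place of upper limits. -/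
noncomputable def lowerAlgEntropy (α : RightAction S A) : EReal :=
  ⨆ (X : Finset A) (_ : X.Nonempty), foelnerLiminf (logTrajectory α X)

end Algebraic

/-! ### Topological entropy of a left action -/

section Topological

variable {S C : Type*} [Mul S] [TopologicalSpace C]

/-- `U` is an open cover of `C`. -/
def IsOpenCover (U : Set (Set C)) : Prop :=
  (∀ u ∈ U, IsOpen u) ∧ ⋃₀ U = Set.univ

/-- `N(U)`: the least positive size of a (finite) subcover of the cover `U`. -/
noncomputable def coverNumber (U : Set (Set C)) : ℕ :=
  sInf {n | 0 < n ∧ ∃ V : Finset (Set C),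
    (V : Set (Set C)) ⊆ U ∧ ⋃₀ (V : Set (Set C)) = Set.univ ∧ V.card = n}

/-- `U_{γ,F}`, the join over `s ∈ F` of the covers `γ(s)⁻¹(U)`: its members are the intersections
over `s ∈ F` of sets `γ(s)⁻¹(u s)` with `u s ∈ U`. -/
def joinCover (γ : S → C → C) (U : Set (Set C)) (F : Finset S) : Set (Set C) :=
  {W | ∃ u : S → Set C, (∀ s ∈ F, u s ∈ U) ∧ W = ⋂ s ∈ F, γ s ⁻¹' u s}

/-- `F ↦ log N(U_{γ,F})`. -/
noncomputable def logCover (γ : S → C → C) (U : Set (Set C)) (F : Finset S) : ℝ :=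
  Real.log (coverNumber (joinCover γ U F))

/-- The topological entropy of a left action `γ` on a compact space: the supremum over open covers
`U` of the limit of `log N(U_{γ,F}) / |F|` over left Følner sets `F`. -/
noncomputable def topEntropy (γ : S → C → C) : EReal :=
  ⨆ (U : Set (Set C)) (_ : IsOpenCover U), foelnerLimsup (logCover γ U)

/-- The topological entropy, with lower limits in place of upper limits. -/
noncomputable def lowerTopEntropy (γ : S → C → C) : EReal :=
  ⨆ (U : Set (Set C)) (_ : IsOpenCover U), foelnerLiminf (logCover γ U)

end Topological

/-- The topological entropy of a left action by continuous endomorphisms. -/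
noncomputable def LeftAction.topEntropy {S K : Type*} [Mul S] [Monoid K] [TopologicalSpace K]
    (γ : LeftAction S K) : EReal :=
  Bridge.topEntropy fun s x => γ.toFun s x

/-- The topological entropy of such an action, with lower limits in place of upper limits. -/
noncomputable def LeftAction.lowerTopEntropy {S K : Type*} [Mul S] [Monoid K]
    [TopologicalSpace K] (γ : LeftAction S K) : EReal :=
  Bridge.lowerTopEntropy fun s x => γ.toFun s x

end Bridge

/-!
The proof rests on two facts about finite subgroups `H` of the torsion group `A`.

*Duality.* Both parts are instances of one situation (`TorsionPairing`): a circle-valued pairing of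
a torsion group `A` with a compact group `K`, faithful on `A`, for which the annihilators `H^⊥` of
finite subgroups form a basis of neighbourhoods of `1` in `K`, and for which the two actions are
adjoint. Finite duality gives `[K : H^⊥] = |H|` (`TorsionPairing.index_annihilator`), and
adjointness gives `T_F(α, H)^⊥ = ⋂ s ∈ F, γ(s)⁻¹ H^⊥`
(`TorsionPairing.mem_annihilator_trajectorySubgroup`). The cover of `K` by the cosets of `H^⊥` has
a join along `F` consisting of the cosets of this intersection, so the logarithm of its covering
number is exactly `log |T_F(α, H)|` (`TorsionPairing.logCover_cosetCover`). Since finite subgroups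
are cofinal among the finite subsets of `A`, and coset covers are cofinal among the open covers of
`K`, both entropies are the supremum over `H` of the same Følner limits, whether upper or lower
limits are taken (`iSup_logTrajectory`, `TorsionPairing.iSup_logCover`).

*Existence of the limit.* The function `F ↦ log |T_F(α, H)|` is not only subadditive but monotone
and submodular, because `|H₁ H₂| |H₁ ∩ H₂| = |H₁| |H₂|`, and it does not increase under right
translation. This replaces the Ornstein–Weiss lemma by Shearer's inequality: if `F` is almost
invariant, the translates `K c`, `c ∈ F`, cover almost every point of `F` exactly `|K|` times,
whence `f(F) / |F| ≤ f(K) / |K| + o(1)` for every `K` (`div_card_le_of_submodular`), and upper and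
lower limits agree (`foelnerLiminf_eq_foelnerLimsup`).

Finally, upper and lower limits can be compared only if the Følner filter is proper, that is, if
Følner sets exist. This is derived from the invariant mean by Day's separation argument in `ℓ¹` and
Namioka's superlevel sets (`LeftAmenable.neBot_foelnerFilter`).
-/

open Filter Topology
open scoped Pointwise

namespace Bridge

/-! ### Følner sets in left cancellative left amenable semigroups -/

section Foelner

variable {S : Type*}

section FinitelyAdditive

variable {μ : Set S → ℝ} (hadd : ∀ F E : Set S, Disjoint F E → μ (F ∪ E) = μ F + μ E)
include hadd

theorem finAdd_empty : μ ∅ = 0 := by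
  have := hadd ∅ ∅ (by simp)
  simpa using this

theorem finAdd_preimage_finset {Ω : Type*} [DecidableEq Ω] (Φ : S → Ω) (T : Finset Ω) :
    μ (Φ ⁻¹' T) = ∑ ω ∈ T, μ (Φ ⁻¹' {ω}) := by
  induction T using Finset.induction_on with
  | empty => simpa using finAdd_empty hadd
  | insert a T ha ih =>
    rw [Finset.sum_insert ha, ← ih, ← hadd _ _ ?_]
    · congr 1
      ext x
      simp
    · rw [Set.disjoint_left]
      intro x hx hx'
      simp only [Set.mem_preimage, Set.mem_singleton_iff, Finset.mem_coe] at hx hx'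
      exact ha (hx ▸ hx')

/-- Change of variables for the integral of a finitely valued function against a finitely additive
measure. -/
theorem finAdd_sum_comp {Ω V : Type*} [Fintype Ω] [Fintype V] (Φ : S → Ω) (π : Ω → V)
    (ψ : V → ℝ) :
    ∑ ω, μ (Φ ⁻¹' {ω}) * ψ (π ω) = ∑ v, μ ((fun x => π (Φ x)) ⁻¹' {v}) * ψ v := by
  classical
  rw [← Finset.sum_fiberwise Finset.univ π]
  refine Finset.sum_congr rfl fun v _ => ?_
  have h : (fun x => π (Φ x)) ⁻¹' {v} = Φ ⁻¹' (({ω | π ω = v} : Finset Ω) : Set Ω) := by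
    ext x
    simp
  rw [h, finAdd_preimage_finset hadd, Finset.sum_mul]
  refine Finset.sum_congr rfl fun ω hω => ?_
  rw [(Finset.mem_filter.1 hω).2]

end FinitelyAdditive

variable [Mul S]

/-- The mean of a coboundary `∑ s, (g s ∘ L_s - g s)` of finitely valued functions vanishes, so the
coboundary is not bounded below by a positive constant. -/
theorem LeftAmenable.exists_sum_sub_lt_of_finite (hS : LeftAmenable S) (E : Finset S) {V : Type*}
    [Fintype V] (val : V → ℝ) (h : S → S → V) {c : ℝ} (hc : 0 < c) :
    ∃ x, ∑ s ∈ E, (val (h s (s * x)) - val (h s x)) < c := by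
  classical
  obtain ⟨μ, hμ, huniv, hadd, hinv⟩ := hS
  by_contra! hle
  -- `μ` is transported to a finite type on which all the functions involved are coordinates.
  let Φ : S → (E → V) × (E → V) := fun x => (fun s => h s (s * x), fun s => h s x)
  have h1 : ∑ ω, μ (Φ ⁻¹' {ω}) = 1 := by
    rw [← finAdd_preimage_finset hadd Φ Finset.univ]
    simpa using huniv
  have h2 : c ≤ ∑ ω, μ (Φ ⁻¹' {ω}) * ∑ s : E, (val (ω.1 s) - val (ω.2 s)) := by
    calc c = ∑ ω, μ (Φ ⁻¹' {ω}) * c := by rw [← Finset.sum_mul, h1, one_mul]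
      _ ≤ _ := by
        refine Finset.sum_le_sum fun ω _ => ?_
        by_cases hω : (Φ ⁻¹' {ω}).Nonempty
        · obtain ⟨x, rfl⟩ := hω
          refine mul_le_mul_of_nonneg_left ?_ (hμ _).1
          have := hle x
          rw [← Finset.sum_coe_sort] at this
          exact this
        · rw [Set.not_nonempty_iff_eq_empty.1 hω, finAdd_empty hadd]
          simp
  have h3 : ∑ ω, μ (Φ ⁻¹' {ω}) * ∑ s : E, (val (ω.1 s) - val (ω.2 s)) = 0 := by
    simp_rw [Finset.mul_sum, mul_sub]
    rw [Finset.sum_comm]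
    refine Finset.sum_eq_zero fun s _ => ?_
    rw [Finset.sum_sub_distrib, finAdd_sum_comp hadd Φ (fun ω => ω.1 s) val,
      finAdd_sum_comp hadd Φ (fun ω => ω.2 s) val, sub_eq_zero]
    refine Finset.sum_congr rfl fun v _ => ?_
    congr 1
    exact hinv s ((fun x => h s x) ⁻¹' {v})
  linarith

/-- A coboundary `∑ s, (g s ∘ L_s - g s)` of bounded functions is not bounded below by a positive
constant. -/
theorem LeftAmenable.exists_sum_sub_lt (hS : LeftAmenable S) (E : Finset S) (g : S → S → ℝ)
    {C : ℝ} (hg : ∀ s x, |g s x| ≤ C) {c : ℝ} (hc : 0 < c) :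
    ∃ x, ∑ s ∈ E, (g s (s * x) - g s x) < c := by
  set δ : ℝ := c / (2 * (E.card + 1)) with hδ
  have hδ0 : 0 < δ := by positivity
  have hEδ : E.card * δ ≤ c / 2 := by
    rw [hδ, ← div_div, mul_div_assoc']
    rw [div_le_iff₀ (by positivity)]
    nlinarith
  let N := ⌊2 * C / δ⌋₊
  have hN : ∀ s x, ⌊(g s x + C) / δ⌋₊ < N + 1 := fun s x => by
    refine Nat.lt_succ_of_le (Nat.floor_mono ?_)
    have := (abs_le.1 (hg s x)).2
    gcongr
    linarith
  let h : S → S → Fin (N + 1) := fun s x => ⟨_, hN s x⟩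
  let val : Fin (N + 1) → ℝ := fun v => δ * v - C
  have hlo : ∀ s x, val (h s x) ≤ g s x := fun s x => by
    have h0 : 0 ≤ (g s x + C) / δ := by
      have := (abs_le.1 (hg s x)).1
      exact div_nonneg (by linarith) hδ0.le
    have := Nat.floor_le h0
    rw [le_div_iff₀ hδ0] at this
    simp only [val, h]
    linarith
  have hhi : ∀ s x, g s x ≤ val (h s x) + δ := fun s x => by
    have := Nat.lt_floor_add_one ((g s x + C) / δ)
    rw [div_lt_iff₀ hδ0] at this
    simp only [val, h]
    linarith
  obtain ⟨x, hx⟩ := hS.exists_sum_sub_lt_of_finite E val h (half_pos hc)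
  refine ⟨x, ?_⟩
  calc ∑ s ∈ E, (g s (s * x) - g s x)
      ≤ ∑ s ∈ E, ((val (h s (s * x)) - val (h s x)) + δ) :=
        Finset.sum_le_sum fun s _ => by linarith [hhi s (s * x), hlo s x]
    _ = ∑ s ∈ E, (val (h s (s * x)) - val (h s x)) + E.card * δ := by
        rw [Finset.sum_add_distrib]; simp
    _ < c := by linarith

/-- Day's theorem: a left amenable semigroup carries finitely supported probability vectors that
are almost invariant in `ℓ¹`. If the vectors `(s φ - φ)_{s ∈ E}` stayed away from `0` in
`ℓ¹(S × S)`, a separating functional would give a coboundary bounded below by a positive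
constant. -/
theorem LeftAmenable.exists_almost_invariant [IsLeftCancelMul S] (hS : LeftAmenable S)
    (E : Finset S) {ε : ℝ} (hε : 0 < ε) :
    ∃ φ : S →₀ ℝ, (∀ x, 0 ≤ φ x) ∧ ∑ x ∈ φ.support, φ x = 1 ∧
      ∑ s ∈ E, ∑ x ∈ φ.support, |φ x - φ (s * x)| < ε := by
  classical
  let X := lp (fun _ : S × S => ℝ) 1
  let d : S × S → X := fun i => lp.single 1 i 1
  -- `Λ φ = ∑ x, φ x • v x` is the vector `(s φ - φ)_{s ∈ E}`.
  let v : S → X := fun x => ∑ s ∈ E, (d (s, s * x) - d (s, x))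
  let Λ : (S →₀ ℝ) →ₗ[ℝ] X := Finsupp.linearCombination ℝ v
  let P : Set (S →₀ ℝ) :=
    {φ | (∀ x, 0 ≤ φ x) ∧ Finsupp.linearCombination ℝ (fun _ => (1 : ℝ)) φ = 1}
  have hP : Convex ℝ P := by
    rintro φ ⟨hφ, hφ1⟩ ψ ⟨hψ, hψ1⟩ a b ha hb hab
    refine ⟨fun x => ?_, ?_⟩
    · have := hφ x
      have := hψ x
      simp only [Finsupp.add_apply, Finsupp.smul_apply, smul_eq_mul]
      positivity
    · rw [map_add, map_smul, map_smul, hφ1, hψ1]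
      simpa using hab
  let ev : S × S → X →ₗ[ℝ] ℝ := fun i =>
    { toFun := fun f => f i, map_add' := fun _ _ => rfl, map_smul' := fun _ _ => rfl }
  have hev : ∀ i j, ev i (d j) = if i = j then 1 else 0 := fun i j => by
    rw [← Pi.single_apply]
    rfl
  have hv : ∀ s ∈ E, ∀ z x, ev (s, s * z) (v x) =
      (if x = z then 1 else 0) - (if x = s * z then 1 else 0) := by
    intro s hs z x
    simp only [v, map_sum, map_sub, hev, Prod.mk.injEq]
    rw [Finset.sum_eq_single_of_mem s hs]
    · simp [eq_comm]
    · intro t _ hts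
      simp [hts.symm]
  -- By left cancellation, the coordinate of `s φ` at `s z` is `φ z`.
  have hcoord : ∀ (φ : S →₀ ℝ), ∀ s ∈ E, ∀ z, (Λ φ : X) (s, s * z) = φ z - φ (s * z) := by
    intro φ s hs z
    change ev (s, s * z) (Λ φ) = _
    simp only [Λ, Finsupp.linearCombination_apply, Finsupp.sum, map_sum, map_smul, hv s hs,
      smul_eq_mul, mul_sub, Finset.sum_sub_distrib]
    simp +contextual [eq_comm]
  by_cases hdisj : Disjoint (Metric.ball (0 : X) ε) (Λ '' P)
  · exfalso
    obtain ⟨f, u, hfu, huf⟩ := geometric_hahn_banach_open (convex_ball _ _) Metric.isOpen_ball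
      (hP.linear_image Λ) hdisj
    have hu : 0 < u := by simpa using hfu 0 (Metric.mem_ball_self hε)
    have hbd : ∀ s x, |f (d (s, x))| ≤ ‖f‖ := fun s x => by
      have := f.le_opNorm (d (s, x))
      rwa [lp.norm_single one_pos, norm_one, mul_one] at this
    obtain ⟨x, hx⟩ := hS.exists_sum_sub_lt E (fun s x => f (d (s, x))) hbd hu
    have h1 : Λ (Finsupp.single x 1) = v x := by simp [Λ]
    have h2 : u ≤ f (v x) := by
      rw [← h1]
      refine huf _ ⟨_, ⟨fun y => ?_, ?_⟩, rfl⟩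
      · rw [Finsupp.single_apply]; split_ifs <;> norm_num
      · simp
    simp only [v, map_sum, map_sub] at h2
    linarith
  · obtain ⟨_, hball, φ, ⟨hφ, hφ1⟩, rfl⟩ := Set.not_disjoint_iff.1 hdisj
    refine ⟨φ, hφ, ?_, ?_⟩
    · simpa [Finsupp.linearCombination_apply, Finsupp.sum] using hφ1
    · rw [mem_ball_zero_iff] at hball
      refine lt_of_le_of_lt ?_ hball
      have hinj : Set.InjOn (fun p : S × S => (p.1, p.1 * p.2))
          (E ×ˢ φ.support : Finset (S × S)) := by
        rintro ⟨s, x⟩ _ ⟨t, y⟩ _ hxy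
        simp only [Prod.mk.injEq] at hxy
        obtain ⟨rfl, h⟩ := hxy
        simpa using h
      have := lp.sum_rpow_le_norm_rpow (p := 1) (by simp) (Λ φ)
        ((E ×ˢ φ.support).image fun p : S × S => (p.1, p.1 * p.2))
      rw [Finset.sum_image hinj, Finset.sum_product] at this
      simp only [ENNReal.toReal_one, Real.rpow_one, Real.norm_eq_abs] at this
      refine le_trans (le_of_eq ?_) this
      exact Finset.sum_congr rfl fun s hs => Finset.sum_congr rfl fun x _ => by rw [hcoord φ s hs]

theorem foelnerRatio_nonneg (s : S) (F : Finset S) : 0 ≤ foelnerRatio s F := by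
  unfold foelnerRatio
  positivity

/-- Namioka's layer argument: some superlevel set of an almost invariant probability vector is a
Følner set. -/
theorem LeftAmenable.exists_foelnerRatio_lt [IsLeftCancelMul S] (hS : LeftAmenable S)
    (E : Finset S) {ε : ℝ} (hε : 0 < ε) :
    ∃ F : Finset S, F.Nonempty ∧ ∀ s ∈ E, foelnerRatio s F < ε := by
  classical
  obtain ⟨φ, hφ, hφ1, hφE⟩ := hS.exists_almost_invariant E hε
  by_contra! hcon
  set T := φ.support
  have hφle : ∀ x ∈ T, φ x ≤ 1 := fun x hx =>
    hφ1 ▸ Finset.single_le_sum (f := φ) (fun y _ => hφ y) hx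
  -- the layer inequality at height `t`
  have key : ∀ t : ℝ, 0 ≤ t → ε * ∑ x ∈ T, (Set.Iio (φ x)).indicator (1 : ℝ → ℝ) t ≤
      ∑ s ∈ E, ∑ x ∈ T, (Set.Ico (φ (s * x)) (φ x)).indicator (1 : ℝ → ℝ) t := by
    intro t ht
    have hcard : ∑ x ∈ T, (Set.Iio (φ x)).indicator (1 : ℝ → ℝ) t =
        ((T.filter fun x => t < φ x).card : ℝ) := by
      simp [Set.indicator_apply]
    have hnn : ∀ s ∈ E, 0 ≤ ∑ x ∈ T, (Set.Ico (φ (s * x)) (φ x)).indicator (1 : ℝ → ℝ) t :=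
      fun s _ => Finset.sum_nonneg fun x _ => Set.indicator_nonneg (by simp) _
    rw [hcard]
    rcases (T.filter fun x => t < φ x).eq_empty_or_nonempty with h0 | hne
    · rw [h0]
      simpa using Finset.sum_nonneg hnn
    obtain ⟨s, hs, hsF⟩ := hcon _ hne
    refine le_trans ?_ (Finset.single_le_sum hnn hs)
    set F := T.filter fun x => t < φ x
    have hFpos : (0 : ℝ) < F.card := by exact_mod_cast hne.card_pos
    rw [foelnerRatio, le_div_iff₀ hFpos] at hsF
    refine hsF.trans ?_
    have hsub : ((fun x => s * x) '' (F : Set S)) \ (F : Set S) ⊆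
        (((T.filter fun x => φ (s * x) ≤ t ∧ t < φ x).image fun x => s * x : Finset S) :
          Set S) := by
      rintro _ ⟨⟨x, hx, rfl⟩, hsx⟩
      simp only [F, Finset.coe_filter, Set.mem_ofPred_eq, T, Finsupp.mem_support_iff] at hx hsx
      simp only [Finset.coe_image, Finset.coe_filter, Set.mem_image, Set.mem_ofPred_eq, T,
        Finsupp.mem_support_iff]
      refine ⟨x, ⟨hx.1, ?_, hx.2⟩, rfl⟩
      by_contra! hlt
      exact hsx ⟨(ht.trans_lt hlt).ne', hlt⟩
    have hle := Set.ncard_le_ncard hsub (Finset.finite_toSet _)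
    rw [Set.ncard_coe_finset] at hle
    have := hle.trans Finset.card_image_le
    calc _ ≤ (((T.filter fun x => φ (s * x) ≤ t ∧ t < φ x).card : ℕ) : ℝ) := by exact_mod_cast this
      _ = _ := by simp [Set.indicator_apply]
  -- integrate over `t ∈ [0, 1)`
  have hint : ∀ A : Set ℝ, MeasurableSet A →
      MeasureTheory.Integrable (A.indicator (1 : ℝ → ℝ))
        (MeasureTheory.volume.restrict (Set.Ico (0 : ℝ) 1)) := fun A hA =>
    (MeasureTheory.integrable_const (1 : ℝ)).indicator hA
  have hI := MeasureTheory.setIntegral_mono_on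
    ((MeasureTheory.integrable_finsetSum T fun x _ => hint _ measurableSet_Iio).const_mul ε)
    (MeasureTheory.integrable_finsetSum E fun s _ =>
      MeasureTheory.integrable_finsetSum T fun x _ => hint (Set.Ico (φ (s * x)) (φ x))
        measurableSet_Ico)
    measurableSet_Ico fun t ht => key t ht.1
  rw [MeasureTheory.integral_const_mul,
    MeasureTheory.integral_finsetSum T fun x _ => hint _ measurableSet_Iio,
    MeasureTheory.integral_finsetSum E fun s _ =>
      MeasureTheory.integrable_finsetSum T fun x _ => hint (Set.Ico (φ (s * x)) (φ x))
        measurableSet_Ico] at hI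
  have hL : ∑ x ∈ T, ∫ t in Set.Ico (0 : ℝ) 1, (Set.Iio (φ x)).indicator (1 : ℝ → ℝ) t = 1 := by
    refine Eq.trans (Finset.sum_congr rfl fun x hx => ?_) hφ1
    rw [MeasureTheory.integral_indicator_one measurableSet_Iio,
      MeasureTheory.measureReal_restrict_apply measurableSet_Iio]
    have : Set.Iio (φ x) ∩ Set.Ico 0 1 = Set.Ico 0 (φ x) := by
      ext t
      have := hφle x hx
      simp only [Set.mem_inter_iff, Set.mem_Iio, Set.mem_Ico]
      grind
    rw [this, Real.volume_real_Ico_of_le (hφ x), sub_zero]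
  have hR : ∑ s ∈ E, ∫ t in Set.Ico (0 : ℝ) 1,
      ∑ x ∈ T, (Set.Ico (φ (s * x)) (φ x)).indicator (1 : ℝ → ℝ) t ≤
      ∑ s ∈ E, ∑ x ∈ T, |φ x - φ (s * x)| := by
    refine Finset.sum_le_sum fun s _ => ?_
    rw [MeasureTheory.integral_finsetSum T fun x _ => hint _ measurableSet_Ico]
    refine Finset.sum_le_sum fun x _ => ?_
    rw [MeasureTheory.integral_indicator_one measurableSet_Ico,
      MeasureTheory.measureReal_restrict_apply measurableSet_Ico]
    refine (MeasureTheory.measureReal_mono Set.inter_subset_left (by simp)).trans ?_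
    rw [Real.volume_real_Ico]
    exact max_le (le_abs_self _) (abs_nonneg _)
  rw [hL] at hI
  linarith

theorem LeftAmenable.neBot_foelnerFilter [IsLeftCancelMul S] (hS : LeftAmenable S) :
    NeBot (foelnerFilter S) := by
  have h : foelnerFilter S =
      𝓟 {F | F.Nonempty} ⊓ comap (fun F s => foelnerRatio s F) (𝓝 (0 : S → ℝ)) := by
    simp only [foelnerFilter, nhds_pi, Filter.pi, comap_iInf, comap_comap, Function.comp_def,
      Pi.zero_apply]
  rw [h, inf_neBot_iff]
  rintro A hA B ⟨W, hW, hWB⟩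
  rw [nhds_pi] at hW
  obtain ⟨⟨I, r⟩, ⟨hI, hr⟩, hIW⟩ :=
    (hasBasis_pi fun _ : S => Metric.nhds_basis_ball (x := (0 : ℝ))).mem_iff.1 hW
  obtain ⟨ε, hεr, hε⟩ : ∃ ε, (∀ s ∈ I, ε ≤ r s) ∧ 0 < ε :=
    (((eventually_all_finite hI).2 fun s hs => nhdsWithin_le_nhds
      (eventually_le_nhds (hr s hs))).and (self_mem_nhdsWithin (s := Set.Ioi 0))).exists
  obtain ⟨F, hF, hFr⟩ := hS.exists_foelnerRatio_lt hI.toFinset hε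
  refine ⟨F, hA hF, hWB (hIW fun s hs => ?_)⟩
  rw [Metric.mem_ball, dist_zero_right, Real.norm_eq_abs,
    abs_of_nonneg (foelnerRatio_nonneg s F)]
  exact (hFr s (hI.mem_toFinset.2 hs)).trans_le (hεr s hs)

end Foelner

/-! ### Shearer's inequality and Følner limits of submodular functions -/

section Submodular

variable {S : Type*} [DecidableEq S] {f : Finset S → ℝ}

/-- Shearer's inequality for monotone submodular functions: if the sets `K i` cover every point of
`F` at least `k` times, then `k f(F) ≤ ∑ f(K i)`. -/
theorem mul_le_sum_of_submodular (hmono : Monotone f) (h0 : f ∅ = 0)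
    (hsub : ∀ E F, f (E ∪ F) + f (E ∩ F) ≤ f E + f F) {ι : Type*} (I : Finset ι)
    (K : ι → Finset S) (k : ℕ) (F : Finset S) (hk : ∀ x ∈ F, k ≤ (I.filter (x ∈ K ·)).card) :
    k * f F ≤ ∑ i ∈ I, f (K i) := by
  suffices h : k * f F ≤ ∑ i ∈ I, f (K i ∩ F) from
    h.trans (Finset.sum_le_sum fun i _ => hmono Finset.inter_subset_left)
  induction F using Finset.induction_on with
  | empty => simp [h0]
  | insert a F ha ih =>
    have ih := ih fun x hx => hk x (Finset.mem_insert_of_mem hx)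
    have hinc : 0 ≤ f (insert a F) - f F := sub_nonneg.2 (hmono (Finset.subset_insert a F))
    -- the marginal gain of `a` over `K i ∩ F` is at least its gain over `F`
    have hstep : ∀ i ∈ I, f (K i ∩ F) + (if a ∈ K i then f (insert a F) - f F else 0) ≤
        f (K i ∩ insert a F) := by
      intro i _
      split_ifs with hi
      · have := hsub (insert a (K i ∩ F)) F
        rw [Finset.insert_union, Finset.union_eq_right.2 Finset.inter_subset_right,
          Finset.insert_inter_of_notMem ha, Finset.inter_assoc, Finset.inter_self] at this
        rw [Finset.inter_insert_of_mem hi]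
        linarith
      · rw [Finset.inter_insert_of_notMem hi, add_zero]
    refine le_trans ?_ (Finset.sum_le_sum hstep)
    rw [Finset.sum_add_distrib, ← Finset.sum_filter, Finset.sum_const, nsmul_eq_mul]
    have hka : (k : ℝ) ≤ (I.filter (a ∈ K ·)).card := by
      exact_mod_cast hk a (Finset.mem_insert_self a F)
    nlinarith [mul_le_mul_of_nonneg_right hka hinc]

theorem le_card_mul_of_submodular (hmono : Monotone f) (h0 : f ∅ = 0)
    (hsub : ∀ E F, f (E ∪ F) + f (E ∩ F) ≤ f E + f F) {M : ℝ} (hM : ∀ s, f {s} ≤ M)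
    (F : Finset S) : f F ≤ F.card * M := by
  induction F using Finset.induction_on with
  | empty => simp [h0]
  | insert a F ha ih =>
    have h1 := hsub {a} F
    have h2 : 0 ≤ f ({a} ∩ F) := h0 ▸ hmono (Finset.empty_subset _)
    rw [Finset.card_insert_of_notMem ha, Finset.insert_eq]
    push_cast
    linarith [hM a]

variable [Mul S] [IsCancelMul S]

theorem card_sdiff_image_eq (k : S) (F : Finset S) (hF : F.Nonempty) :
    ((F \ F.image (k * ·)).card : ℝ) = foelnerRatio k F * F.card := by
  have h1 : (F \ F.image (k * ·)).card = (F.image (k * ·) \ F).card :=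
    Finset.card_sdiff_comm (Finset.card_image_of_injective _ (mul_right_injective k)).symm
  have h2 : (F.card : ℝ) ≠ 0 := by exact_mod_cast hF.card_ne_zero
  rw [foelnerRatio, div_mul_cancel₀ _ h2, h1, ← Set.ncard_coe_finset]
  simp

/-- Quasi-tiling by right translates: up to the few points of `F` outside `⋂ k ∈ K, k F`, the
translates `K c`, `c ∈ F`, cover `F` exactly `|K|` times. -/
theorem div_card_le_of_submodular (hmono : Monotone f) (h0 : f ∅ = 0)
    (hsub : ∀ E F, f (E ∪ F) + f (E ∩ F) ≤ f E + f F) {M : ℝ} (hM : ∀ s, f {s} ≤ M)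
    (hright : ∀ (F : Finset S) (c : S), f (F.image (· * c)) ≤ f F)
    {K F : Finset S} (hK : K.Nonempty) (hF : F.Nonempty) :
    f F / F.card ≤ f K / K.card + (∑ k ∈ K, foelnerRatio k F) * M := by
  set G := F.filter fun x => ∀ k ∈ K, x ∈ F.image (k * ·)
  have hKpos : (0 : ℝ) < K.card := by exact_mod_cast hK.card_pos
  have hFpos : (0 : ℝ) < F.card := by exact_mod_cast hF.card_pos
  have hnn : ∀ E, 0 ≤ f E := fun E => h0 ▸ hmono (Finset.empty_subset _)
  have hM0 : 0 ≤ M := (hnn _).trans (hM hK.choose)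
  have hG : K.card * f G ≤ F.card * f K := by
    refine (mul_le_sum_of_submodular hmono h0 hsub F (fun c => K.image (· * c)) K.card G ?_).trans
      ?_
    · intro x hx
      obtain ⟨-, hx⟩ := Finset.mem_filter.1 hx
      choose! c hc using fun k hk => Finset.mem_image.1 (hx k hk)
      refine Finset.card_le_card_of_injOn c (fun k hk => ?_) fun k hk k' hk' h => ?_
      · simp only [Finset.coe_filter, Set.mem_ofPred_eq, Finset.mem_image]
        exact ⟨(hc k hk).1, k, hk, (hc k hk).2⟩
      · have h1 := (hc k hk).2.trans (hc k' hk').2.symm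
        rw [h] at h1
        exact mul_right_cancel h1
    · rw [← nsmul_eq_mul]
      exact Finset.sum_le_card_nsmul _ _ _ fun c _ => hright K c
  have hdiff : ((F \ G).card : ℝ) ≤ (∑ k ∈ K, foelnerRatio k F) * F.card := by
    rw [Finset.sum_mul]
    simp_rw [← card_sdiff_image_eq _ F hF]
    have hsubs : F \ G ⊆ K.biUnion fun k => F \ F.image (k * ·) := by
      intro x hx
      simp only [G, Finset.mem_sdiff, Finset.mem_filter, not_and, not_forall] at hx
      obtain ⟨hxF, h⟩ := hx
      obtain ⟨k, hk, hkx⟩ := h hxF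
      exact Finset.mem_biUnion.2 ⟨k, hk, Finset.mem_sdiff.2 ⟨hxF, hkx⟩⟩
    exact_mod_cast (Finset.card_le_card hsubs).trans Finset.card_biUnion_le
  have hFG : f F ≤ f G + (F \ G).card * M := by
    have h1 := hsub G (F \ G)
    rw [Finset.union_sdiff_of_subset (Finset.filter_subset _ _)] at h1
    have h2 := le_card_mul_of_submodular hmono h0 hsub hM (F \ G)
    linarith [hnn (G ∩ (F \ G))]
  have hG' : f G ≤ F.card * (f K / K.card) := by
    rw [mul_div_assoc', le_div_iff₀ hKpos]
    linarith
  rw [div_le_iff₀ hFpos]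
  nlinarith [mul_le_mul_of_nonneg_right hdiff hM0]

/-- For monotone, submodular, right subinvariant functions the Følner limit exists; it is the
infimum of `f(K) / |K|`. -/
theorem foelnerLiminf_eq_foelnerLimsup [NeBot (foelnerFilter S)] (hmono : Monotone f)
    (h0 : f ∅ = 0) (hsub : ∀ E F, f (E ∪ F) + f (E ∩ F) ≤ f E + f F) {M : ℝ} (hM : ∀ s, f {s} ≤ M)
    (hright : ∀ (F : Finset S) (c : S), f (F.image (· * c)) ≤ f F) :
    foelnerLiminf f = foelnerLimsup f := by
  have hne : ∀ᶠ F in foelnerFilter S, F.Nonempty :=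
    inf_le_left (a := 𝓟 {F : Finset S | F.Nonempty}) (mem_principal_self _)
  have hratio : ∀ s : S, Tendsto (foelnerRatio s) (foelnerFilter S) (𝓝 0) := fun s =>
    tendsto_iff_comap.2 (inf_le_right.trans (iInf_le _ s))
  refine le_antisymm (liminf_le_limsup) ?_
  have hK : ∀ K : Finset S, K.Nonempty → foelnerLimsup f ≤ ((f K / K.card : ℝ) : EReal) := by
    intro K hK
    have hlim : Tendsto (fun F => ((f K / K.card + (∑ k ∈ K, foelnerRatio k F) * M : ℝ) : EReal))
        (foelnerFilter S) (𝓝 ((f K / K.card : ℝ) : EReal)) := by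
      refine (continuous_coe_real_ereal.tendsto _).comp ?_
      have h1 := (tendsto_finsetSum K fun k _ => hratio k).mul_const M
      simpa using h1.const_add (f K / K.card)
    rw [← hlim.limsup_eq]
    refine limsup_le_limsup ?_
    filter_upwards [hne] with F hF
    exact EReal.coe_le_coe_iff.2 (div_card_le_of_submodular hmono h0 hsub hM hright hK hF)
  exact le_liminf_of_le (by isBoundedDefault) (hne.mono hK)

end Submodular

/-! ### Trajectories of finite subgroups -/

section Trajectory

theorem card_sup_mul_card_inf {A : Type*} [CommGroup A] (H K : Subgroup A) :
    Nat.card ↥(H ⊔ K) * Nat.card ↥(H ⊓ K) = Nat.card H * Nat.card K := by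
  have h1 := Subgroup.relIndex_mul_relIndex ⊥ H (H ⊔ K) bot_le le_sup_left
  have h2 := Subgroup.relIndex_mul_relIndex ⊥ (H ⊓ K) K bot_le inf_le_right
  rw [Subgroup.relIndex_bot_left, Subgroup.relIndex_bot_left] at h1 h2
  rw [← h1, ← h2, Subgroup.inf_relIndex_right, sup_comm, Subgroup.relIndex_sup_right]
  ring

theorem finite_sup {A : Type*} [CommGroup A] {H K : Subgroup A} (hH : (H : Set A).Finite)
    (hK : (K : Set A).Finite) :
    ((H ⊔ K : Subgroup A) : Set A).Finite := by
  rw [Subgroup.mul_normal]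
  exact hH.mul hK

theorem log_card_le_log_card {A : Type*} [CommGroup A] {H K : Subgroup A} (hK : (K : Set A).Finite)
    (h : H ≤ K) :
    Real.log (Nat.card H) ≤ Real.log (Nat.card K) := by
  have : Finite K := hK
  have : Finite H := hK.subset h
  exact Real.log_le_log (by exact_mod_cast Nat.card_pos)
    (by exact_mod_cast Nat.card_mono hK h)

theorem log_card_map_le {A : Type*} [CommGroup A] {H : Subgroup A} (hH : (H : Set A).Finite)
    (f : A →* A) : Real.log (Nat.card (H.map f)) ≤ Real.log (Nat.card H) := by
  have : Finite H := hH
  have : Finite (H.map f) := hH.image f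
  exact Real.log_le_log (by exact_mod_cast Nat.card_pos)
    (by exact_mod_cast Nat.le_of_dvd Nat.card_pos (H.card_map_dvd f))

variable {S A : Type*} [Mul S] [CommGroup A] [TopologicalSpace A]

/-- The trajectory of a subgroup: the subgroup generated by its images under `α(s)`, `s ∈ F`. -/
noncomputable def trajectorySubgroup (α : RightAction S A) (H : Subgroup A) (F : Finset S) :
    Subgroup A :=
  F.sup fun s => H.map (α.toFun s).toMonoidHom

theorem coe_trajectorySubgroup (α : RightAction S A) (H : Subgroup A) {X : Finset A}
    (hX : (X : Set A) = H) (F : Finset S) :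
    (trajectorySubgroup α H F : Set A) = trajectory α X F := by
  classical
  unfold trajectorySubgroup trajectory
  induction F using Finset.induction_on with
  | empty => simp [Set.singleton_one]
  | insert a F ha ih =>
    rw [Finset.sup_insert, Subgroup.mul_normal, Finset.prod_insert ha, ih, hX]
    rfl

theorem finite_trajectorySubgroup (α : RightAction S A) {H : Subgroup A}
    (hH : (H : Set A).Finite) (F : Finset S) : (trajectorySubgroup α H F : Set A).Finite := by
  classical
  unfold trajectorySubgroup
  induction F using Finset.induction_on with
  | empty => simp
  | insert a F ha ih =>
    rw [Finset.sup_insert]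
    exact finite_sup (hH.image _) ih

theorem logTrajectory_eq (α : RightAction S A) {H : Subgroup A} {X : Finset A}
    (hX : (X : Set A) = H) (F : Finset S) :
    logTrajectory α X F = Real.log (Nat.card (trajectorySubgroup α H F)) := by
  rw [logTrajectory, ← coe_trajectorySubgroup α H hX]
  rfl

/-- The sets `E ↦ T_E(α, H)` satisfy `T_{E ∪ F} = T_E T_F` and `T_{E ∩ F} ≤ T_E ∩ T_F`, so
`|HK| |H ∩ K| = |H| |K|` makes `log |T_F|` submodular. -/
theorem foelnerLiminf_logTrajectory [IsCancelMul S] [NeBot (foelnerFilter S)]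
    (α : RightAction S A) {H : Subgroup A} {X : Finset A} (hX : (X : Set A) = H) :
    foelnerLiminf (logTrajectory α X) = foelnerLimsup (logTrajectory α X) := by
  classical
  have hH : (H : Set A).Finite := hX ▸ X.finite_toSet
  have hfin := finite_trajectorySubgroup α hH
  have hpos : ∀ L : Subgroup A, (L : Set A).Finite → (Nat.card L : ℝ) ≠ 0 := fun L hL => by
    have : Finite L := hL
    exact_mod_cast Nat.card_pos.ne'
  have hmonoT : Monotone (trajectorySubgroup α H) := fun E F h => Finset.sup_mono h
  refine foelnerLiminf_eq_foelnerLimsup (M := Real.log (Nat.card H)) ?_ ?_ ?_ ?_ ?_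
  · intro E F h
    rw [logTrajectory_eq α hX, logTrajectory_eq α hX]
    exact log_card_le_log_card (hfin F) (hmonoT h)
  · rw [logTrajectory_eq α hX]
    simp [trajectorySubgroup]
  · intro E F
    simp only [logTrajectory_eq α hX]
    set TE := trajectorySubgroup α H E with hTE
    set TF := trajectorySubgroup α H F with hTF
    have hunion : trajectorySubgroup α H (E ∪ F) = TE ⊔ TF := Finset.sup_union
    have hinter : trajectorySubgroup α H (E ∩ F) ≤ TE ⊓ TF :=
      le_inf (hmonoT Finset.inter_subset_left) (hmonoT Finset.inter_subset_right)
    have hfinf : ((TE ⊓ TF : Subgroup A) : Set A).Finite :=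
      (hfin E).subset (inf_le_left (a := TE) (b := TF))
    have h1 := log_card_le_log_card hfinf hinter
    rw [hunion, ← Real.log_mul (hpos _ (hfin E)) (hpos _ (hfin F)), ← Nat.cast_mul,
      ← card_sup_mul_card_inf, Nat.cast_mul,
      Real.log_mul (hpos _ (finite_sup (hfin E) (hfin F))) (hpos _ hfinf)]
    linarith
  · intro s
    rw [logTrajectory_eq α hX]
    rw [trajectorySubgroup, Finset.sup_singleton]
    exact log_card_map_le hH _
  · intro F c
    rw [logTrajectory_eq α hX, logTrajectory_eq α hX]
    have h : trajectorySubgroup α H (F.image (· * c)) =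
        (trajectorySubgroup α H F).map (α.toFun c).toMonoidHom := by
      rw [trajectorySubgroup, trajectorySubgroup, Finset.sup_image,
        Finset.apply_sup_eq_sup_comp (Subgroup.map (α.toFun c).toMonoidHom)
          (fun K L => Subgroup.map_sup K L _) (Subgroup.map_bot _)]
      refine Finset.sup_congr rfl fun s _ => ?_
      simp only [Function.comp_apply, Subgroup.map_map, α.map_mul]
      rfl
    rw [h]
    exact log_card_map_le (hfin F) _

end Trajectory

/-! ### Covers by cosets -/

section CosetCover

variable {K : Type*} [CommGroup K]

/-- The partition of a group into the cosets of a subgroup. -/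
def cosetCover (L : Subgroup K) : Set (Set K) := Set.range fun x : K => x • (L : Set K)

variable {S : Type*} (γ : S → K →* K) {L : Subgroup K} (F : Finset S) {C : Subgroup K}
  [C.FiniteIndex] (hC : ∀ k, k ∈ C ↔ ∀ s ∈ F, γ s k ∈ L)
include hC

/-- If the cosets of `L` refine `U`, then the cosets of `⋂ s ∈ F, γ(s)⁻¹ L` refine the join of the
covers `γ(s)⁻¹ U`, which thus has a subcover with at most one member for each such coset. -/
theorem exists_subcover_card_le_index {U : Set (Set K)}
    (hU : ∀ x : K, ∃ u ∈ U, x • (L : Set K) ⊆ u) :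
    ∃ V : Finset (Set K), (V : Set (Set K)) ⊆ joinCover (fun s x => γ s x) U F ∧
      ⋃₀ (V : Set (Set K)) = Set.univ ∧ 0 < V.card ∧ V.card ≤ C.index := by
  classical
  choose u huU hu using hU
  have : Fintype (K ⧸ C) := Fintype.ofFinite _
  let W : K ⧸ C → Set K := fun q => ⋂ s ∈ F, γ s ⁻¹' u (γ s q.out)
  refine ⟨Finset.univ.image W, ?_, ?_, ?_, ?_⟩
  · rintro _ hw
    obtain ⟨q, -, rfl⟩ := Finset.mem_image.1 hw
    exact ⟨fun s => u (γ s q.out), fun s _ => huU _, rfl⟩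
  · refine Set.eq_univ_of_forall fun k => ⟨W (k : K ⧸ C), by simp, ?_⟩
    simp only [W, Set.mem_iInter, Set.mem_preimage]
    intro s hs
    refine hu _ ((mem_leftCoset_iff _).2 ?_)
    have h1 : (Quotient.out (k : K ⧸ C))⁻¹ * k ∈ C := QuotientGroup.eq.1 (QuotientGroup.out_eq' _)
    simpa using (hC _).1 h1 s hs
  · exact Finset.card_pos.2 (Finset.univ_nonempty.image W)
  · refine Finset.card_image_le.trans ?_
    rw [Subgroup.index, Nat.card_eq_fintype_card, Finset.card_univ]

theorem coverNumber_le_index {U : Set (Set K)} (hU : ∀ x : K, ∃ u ∈ U, x • (L : Set K) ⊆ u) :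
    coverNumber (joinCover (fun s x => γ s x) U F) ≤ C.index := by
  obtain ⟨V, h1, h2, h3, h4⟩ := exists_subcover_card_le_index γ F hC hU
  exact le_trans (Nat.sInf_le (m := V.card) ⟨h3, V, h1, h2, rfl⟩) h4

/-- The join of the covers `γ(s)⁻¹ (K / L)` consists of cosets of `⋂ s ∈ F, γ(s)⁻¹ L` and of the
empty set, so it has no subcover smaller than the index. -/
theorem coverNumber_cosetCover :
    coverNumber (joinCover (fun s x => γ s x) (cosetCover L) F) = C.index := by
  classical
  have hU : ∀ x, ∃ u ∈ cosetCover L, x • (L : Set K) ⊆ u := fun x => ⟨_, ⟨x, rfl⟩, subset_rfl⟩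
  refine (coverNumber_le_index γ F hC hU).antisymm ?_
  obtain ⟨V₀, h1, h2, h3, -⟩ := exists_subcover_card_le_index γ F hC hU
  have hmem := Nat.sInf_mem (s := {n | 0 < n ∧ ∃ V : Finset (Set K),
    (V : Set (Set K)) ⊆ joinCover (fun s x => γ s x) (cosetCover L) F ∧
      ⋃₀ (V : Set (Set K)) = Set.univ ∧ V.card = n}) ⟨_, h3, V₀, h1, h2, rfl⟩
  obtain ⟨-, V, hV, hVu, hVc⟩ := hmem
  change V.card = coverNumber _ at hVc
  rw [← hVc, Subgroup.index, show V.card = Nat.card V by simp]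
  have hcov : ∀ q : K ⧸ C, ∃ w : V, q.out ∈ (w : Set K) := fun q => by
    obtain ⟨w, hw, hq⟩ := Set.mem_sUnion.1 (hVu ▸ Set.mem_univ q.out)
    exact ⟨⟨w, hw⟩, hq⟩
  choose w hw using hcov
  refine Nat.card_le_card_of_injective w fun q q' hqq => ?_
  have h := hw q
  have h' := hw q'
  rw [← hqq] at h'
  obtain ⟨u, hu, hwu⟩ := hV (w q).2
  rw [hwu] at h h'
  simp only [Set.mem_iInter, Set.mem_preimage] at h h'
  rw [← q.out_eq', ← q'.out_eq']
  refine QuotientGroup.eq.2 ((hC _).2 fun s hs => ?_)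
  obtain ⟨x, hx⟩ := hu s hs
  have e1 := h s hs
  have e2 := h' s hs
  rw [← hx, mem_leftCoset_iff] at e1 e2
  have := L.mul_mem (L.inv_mem e1) e2
  simpa [mul_assoc] using this

end CosetCover

/-! ### Pairings between torsion groups and profinite groups -/

/-- A pairing of a torsion group `A` with a topological group `K`, with values in the circle and
continuous in `K`, which is faithful on `A` and for which the annihilators of the finite subgroups
of `A` form a basis of neighbourhoods of `1` in `K`. The evaluation pairings of a discrete torsion
group with its dual and of the dual of a profinite group with the group itself are of this kind. -/
structure TorsionPairing (A K : Type*) [CommGroup A] [CommGroup K] [TopologicalSpace K] where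
  toHom : A →* K →* Circle
  continuous_toHom : ∀ a, Continuous (toHom a)
  isOfFinOrder : ∀ a : A, IsOfFinOrder a
  injective_toHom : Function.Injective toHom
  exists_annihilator_subset : ∀ U ∈ 𝓝 (1 : K), ∃ H : Subgroup A, (H : Set A).Finite ∧
    {k | ∀ a ∈ H, toHom a k = 1} ⊆ U

theorem log_natCast_le {m n : ℕ} (h : m ≤ n) : Real.log m ≤ Real.log n := by
  rcases m.eq_zero_or_pos with rfl | hm
  · simpa using Real.log_natCast_nonneg n
  · exact Real.log_le_log (by exact_mod_cast hm) (by exact_mod_cast h)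

theorem card_monoidHom_circle (G : Type*) [CommGroup G] [Finite G] :
    Finite (G →* Circle) ∧ Nat.card (G →* Circle) = Nat.card G := by
  have : NeZero (Monoid.exponent G) := ⟨Monoid.exponent_ne_zero_of_finite⟩
  obtain ⟨e⟩ := CommGroup.monoidHom_mulEquiv_of_hasEnoughRootsOfUnity G Circle
  let e' : (G →* Circle) ≃ G :=
    (MulEquiv.monoidHomCongrRight (toUnits (G := Circle))).toEquiv.trans e.toEquiv
  exact ⟨Finite.of_equiv _ e'.symm, Nat.card_congr e'⟩

theorem exists_finite_subgroup_superset {A : Type*} [CommGroup A]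
    (hA : ∀ a : A, IsOfFinOrder a) (X : Finset A) :
    ∃ H : Subgroup A, (H : Set A).Finite ∧ (X : Set A) ⊆ H := by
  classical
  induction X using Finset.induction_on with
  | empty => exact ⟨⊥, by simp, by simp⟩
  | insert a X ha ih =>
    obtain ⟨H, hH, hXH⟩ := ih
    refine ⟨Subgroup.zpowers a ⊔ H, finite_sup (finite_zpowers.2 (hA a)) hH, ?_⟩
    rw [Finset.coe_insert, Set.insert_subset_iff]
    exact ⟨Subgroup.mem_sup_left (Subgroup.mem_zpowers a),
      hXH.trans (le_sup_right (a := Subgroup.zpowers a))⟩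

namespace TorsionPairing

variable {A K : Type*} [CommGroup A] [CommGroup K] [TopologicalSpace K] (P : TorsionPairing A K)

/-- The homomorphism from `K` to the dual of a subgroup of `A`. -/
noncomputable def toDual (H : Subgroup A) : K →* H →* Circle where
  toFun k := (P.toHom.flip k).comp H.subtype
  map_one' := by ext; simp
  map_mul' _ _ := by ext; simp

/-- The annihilator in `K` of a subgroup of `A`. -/
noncomputable def annihilator (H : Subgroup A) : Subgroup K := (P.toDual H).ker

theorem mem_annihilator {H : Subgroup A} {k : K} :
    k ∈ P.annihilator H ↔ ∀ a ∈ H, P.toHom a k = 1 := by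
  simp [annihilator, MonoidHom.mem_ker, toDual, MonoidHom.ext_iff]

theorem mem_annihilator_iff_le {H : Subgroup A} {k : K} :
    k ∈ P.annihilator H ↔ H ≤ (P.toHom.flip k).ker :=
  P.mem_annihilator

theorem annihilator_anti {H H' : Subgroup A} (h : H ≤ H') :
    P.annihilator H' ≤ P.annihilator H := fun _ hk =>
  P.mem_annihilator_iff_le.2 (h.trans (P.mem_annihilator_iff_le.1 hk))

/-- Finite duality: `K / H^⊥` embeds into the dual of `H`, and `H` embeds into the dual of
`K / H^⊥`. -/
theorem index_annihilator {H : Subgroup A} (hH : (H : Set A).Finite) :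
    (P.annihilator H).FiniteIndex ∧ (P.annihilator H).index = Nat.card H := by
  have : Finite H := hH
  obtain ⟨_, hcard⟩ := card_monoidHom_circle H
  have hfin : Finite (K ⧸ P.annihilator H) :=
    Finite.of_equiv _ (QuotientGroup.quotientKerEquivRange (P.toDual H)).symm.toEquiv
  refine ⟨Subgroup.finiteIndex_of_finite_quotient, le_antisymm ?_ ?_⟩
  · rw [annihilator, Subgroup.index_ker, ← hcard]
    exact Nat.card_le_card_of_injective _ Subtype.val_injective
  · obtain ⟨_, hcard'⟩ := card_monoidHom_circle (K ⧸ P.annihilator H)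
    rw [Subgroup.index, ← hcard']
    let f : H → (K ⧸ P.annihilator H →* Circle) := fun a =>
      QuotientGroup.lift _ (P.toHom a) fun k hk => P.mem_annihilator.1 hk a a.2
    refine Nat.card_le_card_of_injective f fun a b hab => Subtype.ext (P.injective_toHom ?_)
    exact MonoidHom.ext fun k => DFunLike.congr_fun hab (k : K ⧸ P.annihilator H)

theorem isOpen_annihilator [IsTopologicalGroup K] {H : Subgroup A} (hH : (H : Set A).Finite) :
    IsOpen (P.annihilator H : Set K) := by
  have := (P.index_annihilator hH).1
  refine Subgroup.isOpen_of_isClosed_of_finiteIndex _ ?_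
  have h : (P.annihilator H : Set K) = ⋂ a ∈ H, P.toHom a ⁻¹' {1} := by
    ext k
    simp [mem_annihilator]
  rw [h]
  exact isClosed_biInter fun a _ => isClosed_singleton.preimage (P.continuous_toHom a)

/-- Every open cover of a compact `K` is refined by the cosets of the annihilator of a finite
subgroup of `A`. -/
theorem exists_cosets_refine [IsTopologicalGroup K] [CompactSpace K] {U : Set (Set K)}
    (hU : IsOpenCover U) : ∃ H : Subgroup A, (H : Set A).Finite ∧
      ∀ x : K, ∃ u ∈ U, x • (P.annihilator H : Set K) ⊆ u := by
  have h1 : ∀ x : K, ∃ H : Subgroup A, (H : Set A).Finite ∧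
      ∃ u ∈ U, x • (P.annihilator H : Set K) ⊆ u := by
    intro x
    obtain ⟨u, huU, hxu⟩ := Set.mem_sUnion.1 (hU.2 ▸ Set.mem_univ x)
    have hnhds : (x * ·) ⁻¹' u ∈ 𝓝 (1 : K) :=
      (continuous_const_mul x).continuousAt.preimage_mem_nhds
        ((hU.1 u huU).mem_nhds (by simpa using hxu))
    obtain ⟨H, hH, hHu⟩ := P.exists_annihilator_subset _ hnhds
    refine ⟨H, hH, u, huU, ?_⟩
    rintro _ ⟨k, hk, rfl⟩
    exact hHu (P.mem_annihilator.1 hk)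
  choose H hH u huU hu using h1
  obtain ⟨T, -, hT⟩ := isCompact_univ.elim_nhds_subcover
    (fun x => x • (P.annihilator (H x) : Set K)) fun x _ =>
      ((P.isOpen_annihilator (hH x)).leftCoset x).mem_nhds
        ((mem_leftCoset_iff x).2 (by simp [(P.annihilator (H x)).one_mem]))
  refine ⟨T.sup H, Finset.sup_induction (p := fun H : Subgroup A => (H : Set A).Finite) (by simp)
    (fun _ h _ h' => finite_sup h h') fun x _ => hH x, fun y => ?_⟩
  obtain ⟨x, hxT, hyx⟩ := Set.mem_iUnion₂.1 (hT (Set.mem_univ y))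
  refine ⟨u x, huU x, fun z hz => hu x ?_⟩
  rw [mem_leftCoset_iff] at hz hyx ⊢
  have := mul_mem hyx (P.annihilator_anti (Finset.le_sup hxT) hz)
  simpa [mul_assoc] using this

/-! ### The bridge between trajectories and covers -/

variable {S : Type*} [Mul S] [TopologicalSpace A] {α : RightAction S A} {γ : LeftAction S K}
  (hαγ : ∀ s a k, P.toHom (α.toFun s a) k = P.toHom a (γ.toFun s k))
include hαγ

/-- The annihilator of `T_F(α, H)` is `⋂ s ∈ F, γ(s)⁻¹ H^⊥`. -/
theorem mem_annihilator_trajectorySubgroup (H : Subgroup A) (F : Finset S) (k : K) :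
    k ∈ P.annihilator (trajectorySubgroup α H F) ↔
      ∀ s ∈ F, (γ.toFun s).toMonoidHom k ∈ P.annihilator H := by
  rw [mem_annihilator_iff_le, trajectorySubgroup, Finset.sup_le_iff]
  refine forall₂_congr fun s _ => ?_
  rw [Subgroup.map_le_iff_le_comap, mem_annihilator]
  refine forall₂_congr fun a _ => ?_
  exact Eq.congr_left (hαγ s a k)

theorem logCover_le {H : Subgroup A} (hH : (H : Set A).Finite) {U : Set (Set K)}
    (hU : ∀ x : K, ∃ u ∈ U, x • (P.annihilator H : Set K) ⊆ u) (F : Finset S) :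
    logCover (fun s x => γ.toFun s x) U F ≤ Real.log (Nat.card (trajectorySubgroup α H F)) := by
  obtain ⟨_, hindex⟩ := P.index_annihilator (finite_trajectorySubgroup α hH F)
  rw [← hindex]
  exact log_natCast_le (coverNumber_le_index (fun s => (γ.toFun s).toMonoidHom) F
    (P.mem_annihilator_trajectorySubgroup hαγ H F) hU)

theorem logCover_cosetCover {H : Subgroup A} (hH : (H : Set A).Finite) (F : Finset S) :
    logCover (fun s x => γ.toFun s x) (cosetCover (P.annihilator H)) F =
      Real.log (Nat.card (trajectorySubgroup α H F)) := by
  obtain ⟨_, hindex⟩ := P.index_annihilator (finite_trajectorySubgroup α hH F)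
  rw [← hindex, ← coverNumber_cosetCover (fun s => (γ.toFun s).toMonoidHom) F
    (P.mem_annihilator_trajectorySubgroup hαγ H F)]
  rfl

/-- Coset covers of annihilators are cofinal among the open covers, so a supremum over open covers
of a monotone functional of `log N` is a supremum over the finite subgroups of `A`. -/
theorem iSup_logCover [IsTopologicalGroup K] [CompactSpace K] {Φ : (Finset S → ℝ) → EReal}
    (hΦ : Monotone Φ) :
    ⨆ (U : Set (Set K)) (_ : IsOpenCover U), Φ (logCover (fun s x => γ.toFun s x) U) =
      ⨆ (H : Subgroup A) (_ : (H : Set A).Finite),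
        Φ fun F => Real.log (Nat.card (trajectorySubgroup α H F)) := by
  refine le_antisymm (iSup₂_le fun U hU => ?_) (iSup₂_le fun H hH => ?_)
  · obtain ⟨H, hH, hHU⟩ := P.exists_cosets_refine hU
    exact le_iSup₂_of_le H hH (hΦ (P.logCover_le hαγ hH hHU))
  · refine le_iSup₂_of_le (cosetCover (P.annihilator H)) ⟨?_, ?_⟩
      (hΦ fun F => (P.logCover_cosetCover hαγ hH F).ge)
    · rintro _ ⟨x, rfl⟩
      exact (P.isOpen_annihilator hH).leftCoset x
    · exact Set.eq_univ_of_forall fun x => ⟨_, ⟨x, rfl⟩,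
        (mem_leftCoset_iff x).2 (by simp [(P.annihilator H).one_mem])⟩

end TorsionPairing

/-- The finite subgroups are cofinal among the finite subsets of a torsion group, so a supremum
over finite sets of a monotone functional of `log |T_F|` is a supremum over finite subgroups. -/
theorem iSup_logTrajectory {S A : Type*} [Mul S] [CommGroup A] [TopologicalSpace A]
    (hA : ∀ a : A, IsOfFinOrder a) (α : RightAction S A) {Φ : (Finset S → ℝ) → EReal}
    (hΦ : Monotone Φ) :
    ⨆ (X : Finset A) (_ : X.Nonempty), Φ (logTrajectory α X) =
      ⨆ (H : Subgroup A) (_ : (H : Set A).Finite),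
        Φ fun F => Real.log (Nat.card (trajectorySubgroup α H F)) := by
  refine le_antisymm (iSup₂_le fun X hX => ?_) (iSup₂_le fun H hH => ?_)
  · obtain ⟨H, hH, hXH⟩ := exists_finite_subgroup_superset hA X
    refine le_iSup₂_of_le H hH (hΦ fun F => log_natCast_le ?_)
    have hfin := finite_trajectorySubgroup α hH F
    refine Set.ncard_le_ncard ?_ hfin
    rw [coe_trajectorySubgroup α H hH.coe_toFinset, trajectory, trajectory]
    refine Set.finsetProd_subset_finsetProd _ _ _ fun s _ => Set.image_mono ?_
    simpa using hXH
  · refine le_iSup₂_of_le hH.toFinset ⟨1, by simp [H.one_mem]⟩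
      (hΦ fun F => (logTrajectory_eq α hH.coe_toFinset F).ge)

section Monotone

variable {S : Type*} [Mul S]

theorem monotone_foelnerLimsup : Monotone (foelnerLimsup (S := S)) := fun f g h =>
  limsup_le_limsup (Eventually.of_forall fun F =>
    EReal.coe_le_coe_iff.2 (div_le_div_of_nonneg_right (h F) (Nat.cast_nonneg _)))

theorem monotone_foelnerLiminf : Monotone (foelnerLiminf (S := S)) := fun f g h =>
  liminf_le_liminf (Eventually.of_forall fun F =>
    EReal.coe_le_coe_iff.2 (div_le_div_of_nonneg_right (h F) (Nat.cast_nonneg _)))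

end Monotone

/-- The bridge theorem for actions that are adjoint with respect to a torsion pairing. -/
theorem TorsionPairing.entropy_eq {S A K : Type*} [Mul S] [IsCancelMul S]
    [NeBot (foelnerFilter S)] [CommGroup A] [TopologicalSpace A] [CommGroup K]
    [TopologicalSpace K] [IsTopologicalGroup K] [CompactSpace K] (P : TorsionPairing A K)
    {α : RightAction S A} {γ : LeftAction S K}
    (hαγ : ∀ s a k, P.toHom (α.toFun s a) k = P.toHom a (γ.toFun s k)) :
    algEntropy α = γ.topEntropy ∧ lowerAlgEntropy α = algEntropy α ∧
      γ.lowerTopEntropy = γ.topEntropy := by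
  have h1 : algEntropy α = _ := iSup_logTrajectory P.isOfFinOrder α monotone_foelnerLimsup
  have h2 : lowerAlgEntropy α = _ := iSup_logTrajectory P.isOfFinOrder α monotone_foelnerLiminf
  have h3 : γ.topEntropy = _ := P.iSup_logCover hαγ monotone_foelnerLimsup
  have h4 : γ.lowerTopEntropy = _ := P.iSup_logCover hαγ monotone_foelnerLiminf
  have h5 : ∀ H : Subgroup A, (H : Set A).Finite →
      (foelnerLiminf fun F => Real.log (Nat.card (trajectorySubgroup α H F))) =
        foelnerLimsup fun F => Real.log (Nat.card (trajectorySubgroup α H F)) := fun H hH => by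
    rw [← funext (logTrajectory_eq α hH.coe_toFinset)]
    exact foelnerLiminf_logTrajectory α hH.coe_toFinset
  have h6 := iSup_congr fun H => iSup_congr (h5 H)
  exact ⟨h1.trans h3.symm, h2.trans (h6.trans h1.symm), h4.trans (h6.trans h3.symm)⟩

/-! ### Characters and the two evaluation pairings -/

/-- The embedding of `ℚ / ℤ` in the circle. -/
theorem exists_injective_addCircle_to_circle :
    ∃ j : AddCircle (1 : ℚ) →+ Additive Circle, Function.Injective j := by
  let i : AddCircle (1 : ℚ) →+ AddCircle (1 : ℝ) :=
    QuotientAddGroup.map _ _ (Rat.castHom ℝ).toAddMonoidHom (by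
      rw [AddSubgroup.zmultiples_le]
      exact AddSubgroup.mem_zmultiples_iff.2 ⟨1, by simp⟩)
  have hi : Function.Injective i := by
    rw [injective_iff_map_eq_zero]
    intro x
    induction x using QuotientAddGroup.induction_on with
    | H q =>
      intro h
      have h' : ((q : ℝ) : AddCircle (1 : ℝ)) = 0 := h
      obtain ⟨n, hn⟩ := (AddCircle.coe_eq_zero_iff _).1 h'
      refine (AddCircle.coe_eq_zero_iff _).2 ⟨n, ?_⟩
      have : ((n • (1 : ℚ) : ℚ) : ℝ) = q := by
        rw [← hn]
        simp
      exact_mod_cast this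
  let t : AddCircle (1 : ℝ) →+ Additive Circle :=
    { toFun := fun x => Additive.ofMul x.toCircle
      map_zero' := by simp
      map_add' := fun x y => by simp [AddCircle.toCircle_add] }
  exact ⟨t.comp i, (AddCircle.injective_toCircle one_ne_zero).comp hi⟩

/-- The characters of an abstract abelian group separate its points. -/
theorem exists_monoidHom_circle_ne_one {G : Type*} [CommGroup G] {g : G} (hg : g ≠ 1) :
    ∃ χ : G →* Circle, χ g ≠ 1 := by
  obtain ⟨c, hc⟩ := CharacterModule.exists_character_apply_ne_zero_of_ne_zero
    (A := Additive G) (a := Additive.ofMul g) hg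
  obtain ⟨j, hj⟩ := exists_injective_addCircle_to_circle
  refine ⟨AddMonoidHom.toMultiplicative (j.comp (show Additive G →+ AddCircle (1 : ℚ) from c)),
    fun h => hc (hj ?_)⟩
  rw [map_zero]
  exact h

/-- Evaluation at a point, as a character of the dual. -/
noncomputable def dualEval {G : Type*} [CommGroup G] [TopologicalSpace G] (x : G) :
    PontryaginDual G →* Circle where
  toFun χ := χ x
  map_one' := rfl
  map_mul' _ _ := rfl

/-- The evaluation pairing of a discrete torsion group with its dual. -/
noncomputable def discretePairing (A : Type*) [CommGroup A] [TopologicalSpace A]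
    [DiscreteTopology A] (hA : ∀ a : A, IsOfFinOrder a) : TorsionPairing A (PontryaginDual A) where
  toHom :=
    { toFun := dualEval
      map_one' := MonoidHom.ext fun χ => map_one χ
      map_mul' := fun a b => MonoidHom.ext fun χ => map_mul χ a b }
  continuous_toHom a := (continuous_apply a).comp
    (ContinuousMonoidHom.isClosedEmbedding_coe (A := A) (B := Circle)).continuous
  isOfFinOrder := hA
  injective_toHom := by
    rw [injective_iff_map_eq_one]
    intro a ha
    by_contra hne
    obtain ⟨χ, hχ⟩ := exists_monoidHom_circle_ne_one hne
    let χ' : PontryaginDual A := (⟨χ, continuous_of_discreteTopology⟩ : A →ₜ* Circle)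
    exact hχ (DFunLike.congr_fun ha χ')
  exists_annihilator_subset U hU := by
    have hind : IsInducing fun (χ : PontryaginDual A) (a : A) => χ a :=
      (ContinuousMonoidHom.isClosedEmbedding_coe (A := A) (B := Circle)).isInducing
    rw [hind.nhds_eq_comap, nhds_pi] at hU
    obtain ⟨W, hW, hWU⟩ := hU
    obtain ⟨I, hI, t, ht, hIW⟩ := Filter.mem_pi.1 hW
    obtain ⟨H, hH, hIH⟩ := exists_finite_subgroup_superset hA hI.toFinset
    refine ⟨H, hH, fun χ hχ => hWU (hIW fun a ha => ?_)⟩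
    have h1 : χ a = 1 := hχ a (hIH (by simpa using ha))
    change χ a ∈ t a
    rw [h1]
    exact mem_of_mem_nhds (ht a)

section Profinite

variable {K : Type*} [CommGroup K] [TopologicalSpace K] [IsTopologicalGroup K]

theorem exists_dual_ne_one (N : OpenNormalSubgroup K) {k : K} (hk : k ∉ N.toSubgroup) :
    ∃ χ : PontryaginDual K, (∀ x ∈ N.toSubgroup, χ x = 1) ∧ χ k ≠ 1 := by
  obtain ⟨χ, hχ⟩ := exists_monoidHom_circle_ne_one
    (g := (k : K ⧸ N.toSubgroup)) (by rwa [Ne, QuotientGroup.eq_one_iff])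
  have : DiscreteTopology (K ⧸ N.toSubgroup) := QuotientGroup.discreteTopology N.isOpen
  let ψ : PontryaginDual K := (⟨χ.comp (QuotientGroup.mk' N.toSubgroup),
    (continuous_of_discreteTopology (f := χ)).comp continuous_quotient_mk'⟩ : K →ₜ* Circle)
  refine ⟨ψ, fun x hx => ?_, hχ⟩
  change χ (x : K ⧸ N.toSubgroup) = 1
  rw [(QuotientGroup.eq_one_iff x).2 hx, map_one]

variable [CompactSpace K]

theorem finite_setOf_eq_one_on (N : OpenNormalSubgroup K) :
    {χ : PontryaginDual K | ∀ x ∈ N.toSubgroup, χ x = 1}.Finite := by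
  have : Finite (K ⧸ N.toSubgroup) := Subgroup.quotient_finite_of_isOpen _ N.isOpen
  obtain ⟨_, -⟩ := card_monoidHom_circle (K ⧸ N.toSubgroup)
  let f : {χ : PontryaginDual K | ∀ x ∈ N.toSubgroup, χ x = 1} → (K ⧸ N.toSubgroup →* Circle) :=
    fun χ => QuotientGroup.lift _ (χ.1 : K →* Circle) χ.2
  refine Finite.of_injective f fun χ ψ h => Subtype.ext (PontryaginDual.ext fun x => ?_)
  exact DFunLike.congr_fun h (x : K ⧸ N.toSubgroup)

variable [TotallyDisconnectedSpace K]

theorem exists_openNormalSubgroup_subset {U : Set K} (hU : U ∈ 𝓝 (1 : K)) :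
    ∃ N : OpenNormalSubgroup K, (N : Set K) ⊆ U := by
  obtain ⟨V, hVU, hV, h1⟩ := mem_nhds_iff.1 hU
  obtain ⟨N, hN⟩ := ProfiniteGrp.exist_openNormalSubgroup_sub_open_nhds_of_one hV h1
  exact ⟨N, hN.trans hVU⟩

/-- A character of a profinite group kills an open subgroup, because the circle has no small
subgroups; hence it is torsion. -/
theorem isOfFinOrder_dual_of_profinite (χ : PontryaginDual K) : IsOfFinOrder χ := by
  have hU : χ ⁻¹' Circle.centeredArc (Real.pi / 2) ∈ 𝓝 (1 : K) := by
    refine (map_continuous χ).continuousAt.preimage_mem_nhds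
      ((Circle.isOpen_centeredArc _).mem_nhds ?_)
    rw [map_one, Circle.mem_centeredArc (by linarith [Real.pi_pos])]
    simp [Real.pi_pos]
  obtain ⟨N, hN⟩ := exists_openNormalSubgroup_subset hU
  have hχN : ∀ x ∈ N.toSubgroup, χ x = 1 := fun x hx =>
    Circle.eq_one_of_forall_pow_mem_centeredArc_pi_div_two fun n _ => by
      rw [← map_pow]
      exact hN (pow_mem hx n)
  have : Finite (K ⧸ N.toSubgroup) := Subgroup.quotient_finite_of_isOpen _ N.isOpen
  refine isOfFinOrder_iff_pow_eq_one.2 ⟨N.toSubgroup.index,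
    Nat.pos_of_ne_zero Subgroup.index_ne_zero_of_finite, PontryaginDual.ext fun x => ?_⟩
  have h : (χ ^ N.toSubgroup.index) x = χ x ^ N.toSubgroup.index := map_pow (dualEval x) χ _
  rw [h, ← map_pow, hχN _ (Subgroup.pow_index_mem _ x)]
  rfl

variable (K)

/-- The evaluation pairing of the dual of a profinite abelian group with the group. -/
noncomputable def profinitePairing : TorsionPairing (PontryaginDual K) K where
  toHom :=
    { toFun := fun χ => (χ : K →* Circle)
      map_one' := rfl
      map_mul' := fun _ _ => rfl }
  continuous_toHom χ := map_continuous χ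
  isOfFinOrder := isOfFinOrder_dual_of_profinite
  injective_toHom χ ψ h := PontryaginDual.ext fun x => DFunLike.congr_fun h x
  exists_annihilator_subset U hU := by
    obtain ⟨N, hN⟩ := exists_openNormalSubgroup_subset hU
    let H : Subgroup (PontryaginDual K) :=
      { carrier := {χ | ∀ x ∈ N.toSubgroup, χ x = 1}
        one_mem' := fun _ _ => rfl
        mul_mem' := fun {χ ψ} hχ hψ x hx => by
          change χ x * ψ x = 1
          rw [hχ x hx, hψ x hx, one_mul]
        inv_mem' := fun {χ} hχ x hx => by
          change (χ x)⁻¹ = 1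
          rw [hχ x hx, inv_one] }
    refine ⟨H, finite_setOf_eq_one_on N, fun k hk => hN ?_⟩
    by_contra hkN
    obtain ⟨χ, hχ, hχk⟩ := exists_dual_ne_one N hkN
    exact hχk (hk χ hχ)

end Profinite

end Bridge

theorem theorem1p2 {S : Type*} [Semigroup S] [IsCancelMul S]
    (hS : Bridge.LeftAmenable S) :
    (∀ (A : Type*) [CommGroup A] [TopologicalSpace A] [DiscreteTopology A],
      (∀ a : A, IsOfFinOrder a) → ∀ α : Bridge.RightAction S A,
        Bridge.algEntropy α = α.dual.topEntropy ∧
        Bridge.lowerAlgEntropy α = Bridge.algEntropy α ∧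
        α.dual.lowerTopEntropy = α.dual.topEntropy) ∧
    (∀ (K : Type*) [CommGroup K] [TopologicalSpace K] [IsTopologicalGroup K] [CompactSpace K]
      [TotallyDisconnectedSpace K] (γ : Bridge.LeftAction S K),
        γ.topEntropy = Bridge.algEntropy γ.dual ∧
        γ.lowerTopEntropy = γ.topEntropy ∧
        Bridge.lowerAlgEntropy γ.dual = Bridge.algEntropy γ.dual) := by
  have := hS.neBot_foelnerFilter
  refine ⟨fun A _ _ _ hA α => ?_, fun K _ _ _ _ _ γ => ?_⟩
  · exact (Bridge.discretePairing A hA).entropy_eq (α := α) (γ := α.dual) fun _ _ _ => rfl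
  · obtain ⟨h1, h2, h3⟩ :=
      (Bridge.profinitePairing K).entropy_eq (α := γ.dual) (γ := γ) fun _ _ _ => rfl
    exact ⟨h1.symm, h3, h2⟩
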